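/- Let $\vec G$ be a finite connected symmetric digraph with at least two vertices (symmetric: $uv$ is an arc if and only if $vu$ is), and let $c$ assign a positive integer $c_{uv}$ to every arc $uv$. A dicycle is a closed directed walk of positive length with no repeated vertex other than its first and last one (in particular $u\to v\to u$ is a dicycle for every arc $uv$ with $u\neq v$). Let $T$ assign a nonnegative integer $T_{uv}$ (a number of tokens) to every arc $uv$; for a dicycle $C$ write $|C|_T=\sum_{uv\in E(C)}T_{uv}$ and $|C|_c=\sum_{uv\in E(C)}c_{uv}$. Assume that $T$ is good, that is, $|C|_T>0$ for every dicycle $C$ and $T_{uv}+T_{vu}=1$ for every arc $uv$. Play the following game in discrete time $t=1,2,3,\dots$, starting with $T_{uv}$ tokens on each arc $uv$. A vertex is fireable at time $t$ if each of its in-arcs carries at least one token at time $t$. At each time all fireable vertices fire simultaneously; a vertex $u$ that fires at time $t$ removes one token from each of its in-arcs at time $t$, and places one token on each out-arc $uv$ at time $t+c_{uv}$, where it is available from time $t+c_{uv}$ on. Let $h(t)$ be the set of vertices that are fireable at time $t$. Then there are positive integers $p$ and $M$ such that $h(t+p)=h(t)$ for all $t\ge M$. Let $p_{(\vec G,c,T)}$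 be the smallest such $p$. There is a positive integer $m_{(\vec G,c,T)}$ such that, for every positive integer $M$ with $h(t+p_{(\vec G,c,T)})=h(t)$ for all $t\ge M$, every vertex is fireable at exactly $m_{(\vec G,c,T)}$ of the times $t$ in $[M,M+p_{(\vec G,c,T)})$. Moreover $$\frac{p_{(\vec G,c,T)}}{m_{(\vec G,c,T)}}=\max_{C}\frac{|C|_c}{|C|_T},$$ where the maximum is taken over all dicycles $C$ of $\vec G$ and is attained. -/

import Mathlib

namespace TokenGame

variable {V : Type*}

/-- A directed cycle `vert 0 → vert 1 → ⋯ → vert n → vert 0` without repeated vertices. The index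
`i + 1` is taken cyclically in `Fin (n + 1)`. Dicycles `u → v → u` of length two are included. -/
structure Dicycle (G : Digraph V) where
  n : ℕ
  vert : Fin (n + 1) → V
  vert_injective : Function.Injective vert
  adj : ∀ i, G.Adj (vert i) (vert (i + 1))

/-- The sum over the arcs of `C` of an arc function: the weight `|C|_c` for `w = c`,
the token count `|C|_T` for `w = T`. -/
def Dicycle.total {G : Digraph V} (C : Dicycle G) (w : V → V → ℕ) : ℕ :=
  ∑ i, w (C.vert i) (C.vert (i + 1))

/-- Good initial markings. Only the values of `T` on arcs matter. -/
def IsGood (G : Digraph V) (T : V → V → ℕ) : Prop :=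
  (∀ C : Dicycle G, 0 < C.total T) ∧ ∀ u v, G.Adj u v → T u v + T v u = 1

open Classical in
/-- The number of tokens on the arc `uv` at time `t`, before the firings at time `t`, when `h s` is
the set of vertices that fire at time `s ≥ 1`: the initial tokens, plus those placed by firings
of `u` at times `s` with `s + c u v ≤ t`, minus those removed by firings of `v` before `t`. -/
noncomputable def tokens (c T : V → V → ℕ) (h : ℕ → Set V) (t : ℕ) (u v : V) : ℤ :=
  (T u v : ℤ) + ((Finset.Ico 1 t).filter (fun s => u ∈ h s ∧ s + c u v ≤ t)).card
    - ((Finset.Ico 1 t).filter (fun s => v ∈ h s)).card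

/-- The vertices that are fireable at time `t`, i.e. all of whose in-arcs carry a token. -/
def fireable (G : Digraph V) (c T : V → V → ℕ) (h : ℕ → Set V) (t : ℕ) : Set V :=
  {v | ∀ u, G.Adj u v → 0 < tokens c T h t u v}

/-- The record of the game up to time `t`: `history G c T t s` is the set of vertices that fire at
time `s`, for `1 ≤ s ≤ t`, and is empty for the other `s`. At each time `1, 2, 3, …`
all fireable vertices fire simultaneously. -/
def history (G : Digraph V) (c T : V → V → ℕ) : ℕ → ℕ → Set V
  | 0 => fun _ => ∅
  | t + 1 => Function.update (history G c T t) (t + 1) (fireable G c T (history G c T t) (t + 1))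

/-- The set `h(t)` of vertices that are fireable, and fire, at time pulse `t ≥ 1`
(with `h(0) = ∅`). -/
def fired (G : Digraph V) (c T : V → V → ℕ) (t : ℕ) : Set V :=
  history G c T t t

theorem history_eq_fired (G : Digraph V) (c T : V → V → ℕ) {s t : ℕ} (hst : s ≤ t) :
    history G c T t s = fired G c T s := by
  induction t with
  | zero =>
    obtain rfl : s = 0 := by omega
    rfl
  | succ t ih =>
    rcases Nat.lt_or_ge t s with h | h
    · obtain rfl : s = t + 1 := by omega
      rfl
    · rw [← ih h, history, Function.update_of_ne (by omega)]

open Classical in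
theorem tokens_congr (c T : V → V → ℕ) {h h' : ℕ → Set V} {t : ℕ}
    (hh : ∀ s, 1 ≤ s → s < t → h s = h' s) (u v : V) :
    tokens c T h t u v = tokens c T h' t u v := by
  have h1 : (Finset.Ico 1 t).filter (fun s => u ∈ h s ∧ s + c u v ≤ t)
      = (Finset.Ico 1 t).filter (fun s => u ∈ h' s ∧ s + c u v ≤ t) :=
    Finset.filter_congr fun s hs => by
      rw [Finset.mem_Ico] at hs
      rw [hh s hs.1 hs.2]
  have h2 : (Finset.Ico 1 t).filter (fun s => v ∈ h s)
      = (Finset.Ico 1 t).filter (fun s => v ∈ h' s) :=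
    Finset.filter_congr fun s hs => by
      rw [Finset.mem_Ico] at hs
      rw [hh s hs.1 hs.2]
  unfold tokens
  rw [h1, h2]

/-- The defining equation of the synchronous game. -/
theorem fired_eq_fireable (G : Digraph V) (c T : V → V → ℕ) {t : ℕ} (ht : 1 ≤ t) :
    fired G c T t = fireable G c T (fired G c T) t := by
  obtain ⟨t, rfl⟩ : ∃ k, t = k + 1 := ⟨t - 1, by omega⟩
  have h1 : fired G c T (t + 1) = fireable G c T (history G c T t) (t + 1) := by
    simp [fired, history]
  rw [h1]
  ext v
  change (∀ u, _ → _) ↔ (∀ u, _ → _)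
  refine forall_congr' fun u => imp_congr_right fun _ => ?_
  rw [tokens_congr c T (fun s _ hs => history_eq_fired G c T (Nat.lt_succ_iff.mp hs)) u v]

/-- From time `M` on, the game repeats itself after every `p` time pulses. -/
def IsSteady (G : Digraph V) (c T : V → V → ℕ) (p M : ℕ) : Prop :=
  0 < p ∧ 0 < M ∧ ∀ t, M ≤ t → fired G c T (t + p) = fired G c T t

/-- `p` is the period of `(G, c, T)`: the smallest `p` for which a steady state exists. -/
def IsPeriod (G : Digraph V) (c T : V → V → ℕ) (p : ℕ) : Prop :=
  IsLeast {p | ∃ M, IsSteady G c T p M} p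

open Classical in
/-- The number of times that the vertex `u` is fireable during the time interval `[M, M + p)`. -/
noncomputable def fireCount (G : Digraph V) (c T : V → V → ℕ) (p M : ℕ) (u : V) : ℕ :=
  ((Finset.Ico M (M + p)).filter (fun t => u ∈ fired G c T t)).card

/-- `m` is the multiplicity of `(G, c, T)`, where `p` is its period: every vertex is fireable exactly
`m` times during each interval `[M, M + p)` in the steady state. -/
def IsMultiplicity (G : Digraph V) (c T : V → V → ℕ) (p m : ℕ) : Prop :=
  ∀ M, IsSteady G c T p M → ∀ u, fireCount G c T p M u = m

end TokenGame

namespace TokenGame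

/-! Let F_v(t) count the firings of v up to time t. Since T_uv + T_vu = 1, every arc holds 0 or 1
token when firing is decided, so F_v(t+1) is the minimum of T_uv + F_u(t+1-c_uv) over in-arcs uv
(`firings_le`, `exists_firings_eq`). A finite state recurs, so eventually F_v(t+p) = F_v(t) + m_v
(`exists_isSteady`), and connectedness makes m_v a constant m (`fireCount_const`). Summing the
inequality over a period gives a potential A with A_v - A_u ≤ p T_uv - m c_uv (`potential_le`).
Around a dicycle A cancels, leaving m|C|_c ≤ p|C|_T. For equality, follow minimizing arcs back in
time until a vertex and its time mod p recur: the resulting closed walk has total slack 0, so each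
of its arcs is tight, and so is any dicycle inside it. -/

theorem exists_forall_le {V : Type*} [Finite V] (c : V → V → ℕ) : ∃ K, ∀ u v, c u v ≤ K := by
  obtain ⟨K, hK⟩ := Set.Finite.bddAbove (Set.finite_range fun x : V × V => c x.1 x.2)
  exact ⟨K, fun u v => hK ⟨(u, v), rfl⟩⟩

open Classical in
/-- The number of firings of `v` at the times `1, …, t`. -/
noncomputable def firings {V : Type*} (G : Digraph V) (c T : V → V → ℕ) (v : V) (t : ℕ) : ℕ :=
  ((Finset.Icc 1 t).filter (fun s => v ∈ fired G c T s)).card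

/-! ### Firing counts as a min-plus recursion -/

section Firings

variable {V : Type*} (G : Digraph V) (c T : V → V → ℕ)

@[simp]
theorem firings_zero (v : V) : firings G c T v 0 = 0 := by
  simp [firings]

open Classical in
theorem firings_succ (v : V) (t : ℕ) :
    firings G c T v (t + 1) = firings G c T v t + if v ∈ fired G c T (t + 1) then 1 else 0 := by
  unfold firings
  rw [← Finset.insert_Icc_right_eq_Icc_add_one (by omega), Finset.filter_insert]
  split_ifs with h
  · rw [Finset.card_insert_of_notMem (by simp)]
  · simp

theorem firings_mono (v : V) : Monotone (firings G c T v) := by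
  refine monotone_nat_of_le_succ fun t => ?_
  rw [firings_succ]
  omega

theorem tokens_fired {u v : V} (hc : 0 < c u v) (t : ℕ) :
    tokens c T (fired G c T) t u v
      = T u v + firings G c T u (t - c u v) - firings G c T v (t - 1) := by
  classical
  unfold tokens firings
  congr 3
  · congr 1
    ext s
    simp only [Finset.mem_filter, Finset.mem_Ico, Finset.mem_Icc]
    constructor
    · rintro ⟨h1, h2, h3⟩
      exact ⟨⟨h1.1, by omega⟩, h2⟩
    · rintro ⟨h1, h2⟩
      exact ⟨⟨h1.1, by omega⟩, h2, by omega⟩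

variable {G c T}

theorem mem_fired_succ_iff (hc : ∀ u v, G.Adj u v → 0 < c u v)
    {v : V} {t : ℕ} :
    v ∈ fired G c T (t + 1) ↔
      ∀ u, G.Adj u v → firings G c T v t < T u v + firings G c T u (t + 1 - c u v) := by
  rw [fired_eq_fireable G c T (by omega)]
  refine forall_congr' fun u => forall_congr' fun huv => ?_
  rw [tokens_fired G c T (hc u v huv), Nat.add_sub_cancel]
  omega

theorem firings_le (hc : ∀ u v, G.Adj u v → 0 < c u v)
    {u v : V} (huv : G.Adj u v) (t : ℕ) :
    firings G c T v t ≤ T u v + firings G c T u (t - c u v) := by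
  induction t with
  | zero => simp
  | succ t ih =>
    rw [firings_succ]
    split_ifs with h
    · exact (mem_fired_succ_iff hc).1 h u huv
    · exact ih.trans (Nat.add_le_add_left (firings_mono G c T u (by omega)) _)

theorem firings_le_add_firings (hc : ∀ u v, G.Adj u v → 0 < c u v)
    {u v : V} (huv : G.Adj u v) (t : ℕ) :
    firings G c T v t ≤ T u v + firings G c T u t :=
  (firings_le hc huv t).trans (Nat.add_le_add_left (firings_mono G c T u (by omega)) _)

/-- An arc never holds two tokens: the bound for the reverse arc vu caps the lead of u over v by
T_vu = 1 - T_uv. -/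
theorem add_firings_le_succ (hc : ∀ u v, G.Adj u v → 0 < c u v)
    (hsymm : ∀ u v, G.Adj u v → G.Adj v u)
    (hT : ∀ u v, G.Adj u v → T u v + T v u = 1) {u v : V} (huv : G.Adj u v) (t : ℕ) :
    T u v + firings G c T u (t + 1 - c u v) ≤ firings G c T v t + 1 := by
  have h1 := firings_le_add_firings (T := T) hc (hsymm u v huv) t
  have h2 := hT u v huv
  have h3 : firings G c T u (t + 1 - c u v) ≤ firings G c T u t :=
    firings_mono G c T u (by have := hc u v huv; omega)
  omega

/-- At every time some in-arc is the one that limits the number of firings. -/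
theorem exists_firings_eq (hc : ∀ u v, G.Adj u v → 0 < c u v)
    (hsymm : ∀ u v, G.Adj u v → G.Adj v u)
    (hT : ∀ u v, G.Adj u v → T u v + T v u = 1) (hdeg : ∀ v, ∃ u, G.Adj u v) (v : V) (t : ℕ) :
    ∃ u, G.Adj u v ∧
      firings G c T v (t + 1) = T u v + firings G c T u (t + 1 - c u v) := by
  -- If v fires, every in-arc held exactly one token, so any of them is limiting; otherwise an empty
  -- in-arc is.
  by_cases h : v ∈ fired G c T (t + 1)
  · obtain ⟨u, hu⟩ := hdeg v
    have h1 := firings_le (T := T) hc hu (t + 1)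
    have h2 := add_firings_le_succ hc hsymm hT hu t
    have h3 := firings_succ G c T v t
    rw [if_pos h] at h3
    exact ⟨u, hu, by omega⟩
  · have h' := h
    rw [mem_fired_succ_iff hc] at h'
    push Not at h'
    obtain ⟨u, hu, h1⟩ := h'
    have h2 := firings_le (T := T) hc hu (t + 1)
    have h3 := firings_succ G c T v t
    rw [if_neg h] at h3
    exact ⟨u, hu, by omega⟩

end Firings

/-! ### Eventual periodicity and the potential inequality -/

section Steady

variable {V : Type*} {G : Digraph V} {c T : V → V → ℕ}

theorem exists_isSteady [Finite V] (hsymm : ∀ u v, G.Adj u v → G.Adj v u)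
    (hc : ∀ u v, G.Adj u v → 0 < c u v) (hT : ∀ u v, G.Adj u v → T u v + T v u = 1) :
    ∃ p M, IsSteady G c T p M := by
  classical
  obtain ⟨K, hK⟩ := exists_forall_le c
  -- A state is one bit per arc (is there a token at time a+K+1?) and the last K+1 firing sets. As
  -- an arc holds 0 or 1 token, the bit fixes the count, and K bounds how long tokens are in
  -- transit.
  let S : ℕ → (V → V → Prop) × (Fin (K + 1) → Set V) := fun a =>
    (fun u v => firings G c T v (a + K) < T u v + firings G c T u (a + K + 1 - c u v),
      fun i => fired G c T (a + i))
  obtain ⟨a, b, hab, hS⟩ : ∃ a b, a < b ∧ S a = S b := by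
    obtain ⟨a, b, hne, h⟩ := Finite.exists_ne_map_eq_of_infinite S
    rcases lt_or_gt_of_ne hne with h' | h'
    · exact ⟨a, b, h', h⟩
    · exact ⟨b, a, h', h.symm⟩
  have key : ∀ k, (∀ i < K + 1 + k, fired G c T (a + i) = fired G c T (b + i)) ∧
      ∀ u v, G.Adj u v →
        (firings G c T v (a + K + k) : ℤ) - firings G c T u (a + K + k + 1 - c u v)
        = firings G c T v (b + K + k) - firings G c T u (b + K + k + 1 - c u v) := by
    intro k
    induction k with
    | zero =>
      refine ⟨fun i hi => congrFun (congrArg Prod.snd hS) ⟨i, hi⟩, fun u v huv => ?_⟩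
      have h1 : (firings G c T v (a + K) < T u v + firings G c T u (a + K + 1 - c u v)) =
          (firings G c T v (b + K) < T u v + firings G c T u (b + K + 1 - c u v)) :=
        congrFun (congrFun (congrArg Prod.fst hS) u) v
      have h2 := add_firings_le_succ hc hsymm hT huv (a + K)
      have h3 := add_firings_le_succ hc hsymm hT huv (b + K)
      have h4 := (firings_le (T := T) hc huv (a + K)).trans
        (Nat.add_le_add_left (firings_mono G c T u
          (show a + K - c u v ≤ a + K + 1 - c u v by omega)) _)
      have h5 := (firings_le (T := T) hc huv (b + K)).trans
        (Nat.add_le_add_left (firings_mono G c T u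
          (show b + K - c u v ≤ b + K + 1 - c u v by omega)) _)
      have h6 := h1.to_iff
      simp only [Nat.add_zero]
      omega
    | succ k ih =>
      obtain ⟨ih1, ih2⟩ := ih
      have hf : ∀ i < K + 1 + (k + 1), fired G c T (a + i) = fired G c T (b + i) := by
        intro i hi
        rcases Nat.lt_or_ge i (K + 1 + k) with h | h
        · exact ih1 i h
        · obtain rfl : i = K + k + 1 := by omega
          ext v
          rw [show a + (K + k + 1) = a + K + k + 1 by omega,
            show b + (K + k + 1) = b + K + k + 1 by omega,
            mem_fired_succ_iff hc, mem_fired_succ_iff hc]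
          refine forall_congr' fun u => forall_congr' fun huv => ?_
          have := ih2 u v huv
          omega
      refine ⟨hf, fun u v huv => ?_⟩
      have h1 := firings_succ G c T v (a + K + k)
      have h2 := firings_succ G c T v (b + K + k)
      have h3 := firings_succ G c T u (a + K + k + 1 - c u v)
      have h4 := firings_succ G c T u (b + K + k + 1 - c u v)
      have hcK := hK u v
      have hc0 := hc u v huv
      have e1 := hf (K + k + 1) (by omega)
      -- Tokens arriving next on uv were fired at this offset: nonnegative as c_uv ≤ K, and already
      -- compared as c_uv > 0.
      have e2 := hf (K + k + 2 - c u v) (by omega)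
      rw [show a + (K + k + 1) = a + K + k + 1 by omega,
        show b + (K + k + 1) = b + K + k + 1 by omega] at e1
      rw [show a + (K + k + 2 - c u v) = a + K + k + 1 - c u v + 1 by omega,
        show b + (K + k + 2 - c u v) = b + K + k + 1 - c u v + 1 by omega] at e2
      rw [e1] at h1
      rw [e2] at h3
      have h5 := ih2 u v huv
      rw [← Nat.add_assoc, ← Nat.add_assoc,
        show a + K + k + 1 + 1 - c u v = a + K + k + 1 - c u v + 1 by omega,
        show b + K + k + 1 + 1 - c u v = b + K + k + 1 - c u v + 1 by omega, h1, h2, h3, h4]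
      push_cast
      linarith
  refine ⟨b - a, a + 1, by omega, by omega, fun t ht => ?_⟩
  have := (key (t - a)).1 (t - a) (by omega)
  rw [show a + (t - a) = t by omega, show b + (t - a) = t + (b - a) by omega] at this
  exact this.symm

theorem fireCount_eq (G : Digraph V) (c T : V → V → ℕ) (p M : ℕ) (v : V) :
    firings G c T v (M + p) = firings G c T v M + fireCount G c T p (M + 1) v := by
  classical
  unfold firings fireCount
  rw [← Finset.card_union_of_disjoint, ← Finset.filter_union]
  · congr 2
    ext s
    simp only [Finset.mem_union, Finset.mem_Ico, Finset.mem_Icc]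
    omega
  · refine Finset.disjoint_filter_filter ?_
    rw [Finset.disjoint_left]
    intro s
    simp only [Finset.mem_Ico, Finset.mem_Icc]
    omega

/-- The firings of `v` summed over a period. -/
noncomputable def potential (G : Digraph V) (c T : V → V → ℕ) (p t : ℕ) (v : V) : ℕ :=
  ∑ s ∈ Finset.range p, firings G c T v (t + s)

namespace IsSteady

variable {p M : ℕ}

theorem firings_add (h : IsSteady G c T p M) (v : V) {t : ℕ} (ht : M ≤ t + 1) :
    firings G c T v (t + p) = firings G c T v t + fireCount G c T p M v := by
  obtain ⟨hp, hM, h⟩ := h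
  obtain ⟨M, rfl⟩ : ∃ k, M = k + 1 := ⟨M - 1, by omega⟩
  obtain ⟨k, rfl⟩ : ∃ k, t = M + k := ⟨t - M, by omega⟩
  clear ht
  induction k with
  | zero => exact fireCount_eq G c T p M v
  | succ k ih =>
    have h1 := h (M + k + 1) (by omega)
    rw [← Nat.add_assoc, Nat.add_right_comm _ 1 p, firings_succ, firings_succ, ih,
      Nat.add_right_comm _ p 1, h1]
    omega

theorem firings_add_mul (h : IsSteady G c T p M) (v : V) {t : ℕ} (ht : M ≤ t + 1) (k : ℕ) :
    firings G c T v (t + k * p) = firings G c T v t + k * fireCount G c T p M v := by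
  induction k with
  | zero => simp
  | succ k ih =>
    rw [Nat.succ_mul, ← Nat.add_assoc, h.firings_add v (by omega), ih]
    ring

theorem fireCount_eq_fireCount {M' : ℕ} (h : IsSteady G c T p M) (h' : IsSteady G c T p M')
    (v : V) : fireCount G c T p M v = fireCount G c T p M' v := by
  have h1 := h.firings_add v (t := M + M') (by omega)
  have h2 := h'.firings_add v (t := M + M') (by omega)
  omega

/-- If v fired more often per period than u, the arc uv would run out of tokens; T_uv + F_u(M) + 1
periods suffice. -/
theorem fireCount_le_of_adj (hc : ∀ u v, G.Adj u v → 0 < c u v) (h : IsSteady G c T p M) {u v : V}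
    (huv : G.Adj u v) : fireCount G c T p M v ≤ fireCount G c T p M u := by
  by_contra! hlt
  have h1 := h.firings_add_mul u (t := M) (by omega) (T u v + firings G c T u M + 1)
  have h2 := h.firings_add_mul v (t := M) (by omega) (T u v + firings G c T u M + 1)
  have h3 := firings_le_add_firings (T := T) hc huv (M + (T u v + firings G c T u M + 1) * p)
  have h4 := Nat.mul_le_mul_left (T u v + firings G c T u M + 1) (Nat.succ_le_of_lt hlt)
  rw [Nat.succ_eq_add_one, Nat.mul_add, Nat.mul_one] at h4
  omega

theorem fireCount_const (hsymm : ∀ u v, G.Adj u v → G.Adj v u)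
    (hconn : G.toSimpleGraphInclusive.Connected) (hc : ∀ u v, G.Adj u v → 0 < c u v)
    (h : IsSteady G c T p M) (u v : V) : fireCount G c T p M u = fireCount G c T p M v := by
  obtain ⟨w⟩ := hconn.preconnected u v
  induction w with
  | nil => rfl
  | cons hadj _ ih =>
    rw [← ih]
    rw [Digraph.toSimpleGraphInclusive, SimpleGraph.fromRel_adj] at hadj
    have h1 := hadj.2.elim id (hsymm _ _)
    exact le_antisymm (h.fireCount_le_of_adj hc (hsymm _ _ h1)) (h.fireCount_le_of_adj hc h1)

theorem potential_add (h : IsSteady G c T p M) (v : V) {t : ℕ} (ht : M ≤ t + 1) (k : ℕ) :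
    potential G c T p (t + k) v = potential G c T p t v + k * fireCount G c T p M v := by
  induction k with
  | zero => simp
  | succ k ih =>
    -- Sliding the window by one replaces its first term by the term p later.
    have h1 : potential G c T p (t + (k + 1)) v + firings G c T v (t + k)
        = potential G c T p (t + k) v + firings G c T v (t + k + p) := by
      unfold potential
      rw [← Finset.sum_range_succ (fun s => firings G c T v (t + k + s)), Finset.sum_range_succ']
      simp only [Nat.add_zero, Nat.add_assoc, Nat.add_comm 1]
    have h2 := h.firings_add v (t := t + k) (by omega)
    rw [Nat.succ_mul]
    omega

/-- Summing over a full period makes a shift by any delay, not just a multiple of p, change the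
total by exactly the delay times the fire count. -/
theorem potential_le (hc : ∀ u v, G.Adj u v → 0 < c u v) (h : IsSteady G c T p M) {u v : V}
    (huv : G.Adj u v) {t : ℕ} (ht : M + c u v ≤ t) :
    potential G c T p t v + c u v * fireCount G c T p M u
      ≤ p * T u v + potential G c T p t u := by
  have h1 := h.potential_add u (t := t - c u v) (by omega) (c u v)
  rw [Nat.sub_add_cancel (by omega)] at h1
  rw [h1, ← Nat.add_assoc]
  refine Nat.add_le_add_right ?_ _
  calc potential G c T p t v
      ≤ ∑ s ∈ Finset.range p, (T u v + firings G c T u (t - c u v + s)) :=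
        Finset.sum_le_sum fun s _ => by
          rw [show t - c u v + s = t + s - c u v by omega]
          exact firings_le hc huv _
    _ = p * T u v + potential G c T p (t - c u v) u := by
        rw [Finset.sum_add_distrib]
        simp [potential]

end IsSteady

end Steady

/-! ### The bound over dicycles and its attainment -/

theorem sum_comp_add_one {n : ℕ} (f : Fin (n + 1) → ℤ) : ∑ i, f (i + 1) = ∑ i, f i :=
  Equiv.sum_comp (Equiv.addRight (1 : Fin (n + 1))) f

/-- A closed walk contains a cycle without repeated vertices. -/
theorem exists_injective_cycle {V : Type*} (R : V → V → Prop) (y : ℕ → V) {a b : ℕ} (hab : a < b)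
    (hy : y a = y b) (hR : ∀ k, a ≤ k → k < b → R (y k) (y (k + 1))) :
    ∃ (n : ℕ) (f : Fin (n + 1) → V), Function.Injective f ∧ ∀ i, R (f i) (f (i + 1)) := by
  induction hL : b - a using Nat.strong_induction_on generalizing a b with
  | _ L ih =>
    by_cases hinj : ∃ a' b', a ≤ a' ∧ a' < b' ∧ b' < b ∧ y a' = y b'
    · obtain ⟨a', b', h1, h2, h3, h4⟩ := hinj
      exact ih (b' - a') (by omega) h2 h4 (fun k _ _ => hR k (by omega) (by omega)) rfl
    · push Not at hinj
      refine ⟨b - a - 1, fun i => y (a + i), fun i j hij => ?_, fun i => ?_⟩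
      · rcases lt_trichotomy i j with h | h | h
        · exact absurd hij (hinj _ _ (by omega) (by omega) (by omega))
        · exact h
        · exact absurd hij.symm (hinj _ _ (by omega) (by omega) (by omega))
      · have h := hR (a + i) (by omega) (by omega)
        -- The last arc wraps around, by y a = y b.
        rcases eq_or_ne i (Fin.last _) with rfl | hi
        · simp only [Fin.last_add_one, Fin.val_zero, Nat.add_zero, Fin.val_last] at h ⊢
          rwa [hy, ← show a + (b - a - 1) + 1 = b by omega,
            show a + (a + (b - a - 1) + 1 - a - 1) = a + (b - a - 1) by omega]
        · simp only
          rwa [Fin.val_add_one_of_lt (Fin.lt_last_iff_ne_last.2 hi)]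

namespace IsSteady

variable {V : Type*} {G : Digraph V} {c T : V → V → ℕ} {p M m : ℕ}

theorem mul_total_le (hc : ∀ u v, G.Adj u v → 0 < c u v) (h : IsSteady G c T p M)
    (hm : ∀ v, fireCount G c T p M v = m) (C : Dicycle G) :
    m * C.total c ≤ p * C.total T := by
  let K := C.total c
  have hK : ∀ i, c (C.vert i) (C.vert (i + 1)) ≤ K := fun i =>
    Finset.single_le_sum (f := fun i => c (C.vert i) (C.vert (i + 1)))
      (fun _ _ => Nat.zero_le _) (Finset.mem_univ i)
  let A : V → ℕ := potential G c T p (M + K)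
  have key : ∑ i, ((A (C.vert (i + 1)) : ℤ) + m * c (C.vert i) (C.vert (i + 1)))
      ≤ ∑ i, ((p : ℤ) * T (C.vert i) (C.vert (i + 1)) + A (C.vert i)) := by
    refine Finset.sum_le_sum fun i _ => ?_
    have := h.potential_le hc (C.adj i) (t := M + K) (by have := hK i; omega)
    rw [hm, Nat.mul_comm] at this
    exact_mod_cast this
  rw [Finset.sum_add_distrib, Finset.sum_add_distrib,
    sum_comp_add_one (fun i => (A (C.vert i) : ℤ)), ← Finset.mul_sum, ← Finset.mul_sum] at key
  unfold Dicycle.total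
  zify
  linarith

/-- Going back in time along limiting arcs, one returns to the same vertex in the same phase. -/
theorem exists_tight_closed_walk [Finite V] (hsymm : ∀ u v, G.Adj u v → G.Adj v u)
    (hc : ∀ u v, G.Adj u v → 0 < c u v) (hT : ∀ u v, G.Adj u v → T u v + T v u = 1)
    (hdeg : ∀ v, ∃ u, G.Adj u v) [Nonempty V] (h : IsSteady G c T p M)
    (hm : ∀ v, fireCount G c T p M v = m) :
    ∃ (L : ℕ) (y : ℕ → V), 0 < L ∧ y 0 = y L ∧ (∀ k < L, G.Adj (y k) (y (k + 1))) ∧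
      p * ∑ k ∈ Finset.range L, T (y k) (y (k + 1))
        = m * ∑ k ∈ Finset.range L, c (y k) (y (k + 1)) := by
  classical
  have hp := h.1
  have hM := h.2.1
  obtain ⟨K, hK⟩ := exists_forall_le c
  choose pre hpre using exists_firings_eq (T := T) hc hsymm hT hdeg
  let step : V × ℕ → V × ℕ := fun x =>
    (pre x.1 (x.2 - 1), x.2 - c (pre x.1 (x.2 - 1)) x.1)
  let B := Nat.card (V × Fin p)
  -- Each step goes back at most K, so B+1 steps stay at times ≥ M: subtraction is never truncated
  -- and the steady state applies.
  let x : ℕ → V × ℕ := fun i => step^[i] (Classical.arbitrary V, M + (B + 1) * K)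
  have hx : ∀ i, x (i + 1) = step (x i) := fun i => Function.iterate_succ_apply' ..
  have hlow : ∀ i ≤ B + 1, M + (B + 1 - i) * K ≤ (x i).2 := by
    intro i
    induction i with
    | zero => intro _; exact le_rfl
    | succ i ih =>
      intro hi
      have h1 := ih (by omega)
      have h2 := hK (pre (x i).1 ((x i).2 - 1)) (x i).1
      rw [hx]
      change _ ≤ (x i).2 - c (pre (x i).1 ((x i).2 - 1)) (x i).1
      rw [show B + 1 - i = B + 1 - (i + 1) + 1 by omega, Nat.succ_mul] at h1
      omega
  have hlow' : ∀ i ≤ B + 1, M ≤ (x i).2 := fun i hi => le_trans (by omega) (hlow i hi)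
  have hstep : ∀ i ≤ B, G.Adj (x (i + 1)).1 (x i).1 ∧
      firings G c T (x i).1 (x i).2
        = T (x (i + 1)).1 (x i).1 + firings G c T (x (i + 1)).1 (x (i + 1)).2 ∧
      (x i).2 = c (x (i + 1)).1 (x i).1 + (x (i + 1)).2 := by
    intro i hi
    have h1 := hlow' i (by omega)
    have h2 := hlow' (i + 1) (by omega)
    have h3 := hpre (x i).1 ((x i).2 - 1)
    rw [Nat.sub_add_cancel (by omega)] at h3
    rw [hx] at h2 ⊢
    change M ≤ (x i).2 - c (pre (x i).1 ((x i).2 - 1)) (x i).1 at h2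
    refine ⟨h3.1, h3.2, ?_⟩
    change (x i).2 = c (pre (x i).1 ((x i).2 - 1)) (x i).1
      + ((x i).2 - c (pre (x i).1 ((x i).2 - 1)) (x i).1)
    omega
  have hsum : ∀ i d, i + d ≤ B + 1 →
      firings G c T (x i).1 (x i).2
        = ∑ k ∈ Finset.range d, T (x (i + k + 1)).1 (x (i + k)).1
          + firings G c T (x (i + d)).1 (x (i + d)).2 ∧
      (x i).2 = ∑ k ∈ Finset.range d, c (x (i + k + 1)).1 (x (i + k)).1 + (x (i + d)).2 := by
    intro i d
    induction d with
    | zero => simp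
    | succ d ih =>
      intro hd
      obtain ⟨h1, h2⟩ := ih (by omega)
      obtain ⟨-, h3, h4⟩ := hstep (i + d) (by omega)
      rw [Finset.sum_range_succ, Finset.sum_range_succ, ← Nat.add_assoc]
      constructor <;> omega
  obtain ⟨i, j, hij, hj, hv, hmod⟩ : ∃ i j, i < j ∧ j ≤ B ∧ (x i).1 = (x j).1 ∧
      (x i).2 % p = (x j).2 % p := by
    let f : Fin (B + 1) → V × Fin p := fun i => ((x i).1, ⟨(x i).2 % p, Nat.mod_lt _ hp⟩)
    have hf : ¬ Function.Injective f := fun hf => by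
      have := Nat.card_le_card_of_injective f hf
      rw [Nat.card_fin] at this
      omega
    simp only [Function.Injective, not_forall] at hf
    obtain ⟨i, j, he, hne⟩ := hf
    have h1 : (x i).1 = (x j).1 := (Prod.ext_iff.1 he).1
    have h2 : (x i).2 % p = (x j).2 % p := Fin.ext_iff.1 (Prod.ext_iff.1 he).2
    rcases lt_or_gt_of_ne hne with hlt | hlt
    · exact ⟨i, j, hlt, by omega, h1, h2⟩
    · exact ⟨j, i, hlt, by omega, h1.symm, h2.symm⟩
  obtain ⟨d, rfl⟩ : ∃ d, j = i + d := ⟨j - i, by omega⟩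
  obtain ⟨h1, h2⟩ := hsum i d (by omega)
  obtain ⟨k, hk⟩ : ∃ k, (x i).2 = (x (i + d)).2 + k * p := by
    have h3 : p ∣ (x i).2 - (x (i + d)).2 := (Nat.modEq_iff_dvd' (by omega)).1 hmod.symm
    obtain ⟨k, hk⟩ := h3
    exact ⟨k, by rw [Nat.mul_comm]; omega⟩
  -- Between the two visits lie k periods: the delays sum to kp, and the tokens, which account for
  -- the drop in firings, to km.
  have h3 := h.firings_add_mul (x i).1 (t := (x (i + d)).2)
    (by have := hlow' (i + d) (by omega); omega) k
  rw [← hk, hm, h1, ← hv] at h3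
  -- The sequence x runs against the arcs, so the walk is read in reverse.
  have hrev : ∀ w : V → V → ℕ,
      ∑ k ∈ Finset.range d, w (x (i + (d - k))).1 (x (i + (d - (k + 1)))).1
        = ∑ k ∈ Finset.range d, w (x (i + k + 1)).1 (x (i + k)).1 := by
    intro w
    rw [← Finset.sum_range_reflect]
    refine Finset.sum_congr rfl fun k hk => ?_
    have := Finset.mem_range.1 hk
    rw [show d - (d - 1 - k) = k + 1 by omega, show d - (d - 1 - k + 1) = k by omega,
      Nat.add_assoc]
  refine ⟨d, fun k => (x (i + (d - k))).1, by omega, ?_, fun k hk => ?_, ?_⟩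
  · simpa using hv.symm
  · have := (hstep (i + (d - (k + 1))) (by omega)).1
    rwa [show i + (d - (k + 1)) + 1 = i + (d - k) by omega] at this
  · rw [hrev T, hrev c]
    have e1 : ∑ k ∈ Finset.range d, T (x (i + k + 1)).1 (x (i + k)).1 = k * m := by omega
    have e2 : ∑ k ∈ Finset.range d, c (x (i + k + 1)).1 (x (i + k)).1 = k * p := by omega
    rw [e1, e2]
    ring

/-- A subcycle of the closed walk need not return in the same phase, so its equality comes from the
slacks: they are nonnegative with sum 0, hence all vanish. -/
theorem exists_mul_total_eq [Finite V] (hsymm : ∀ u v, G.Adj u v → G.Adj v u)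
    (hc : ∀ u v, G.Adj u v → 0 < c u v) (hT : ∀ u v, G.Adj u v → T u v + T v u = 1)
    (hdeg : ∀ v, ∃ u, G.Adj u v) [Nonempty V] (h : IsSteady G c T p M)
    (hm : ∀ v, fireCount G c T p M v = m) :
    ∃ C : Dicycle G, p * C.total T = m * C.total c := by
  obtain ⟨L, y, hL, hy, hadj, hsum⟩ := h.exists_tight_closed_walk hsymm hc hT hdeg hm
  obtain ⟨K, hK⟩ := exists_forall_le c
  let A : V → ℤ := fun v => potential G c T p (M + K) v
  let w : V → V → ℤ := fun u v => p * T u v - m * c u v - (A v - A u)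
  have hw : ∀ u v, G.Adj u v → 0 ≤ w u v := by
    intro u v huv
    have := h.potential_le hc huv (t := M + K) (by have := hK u v; omega)
    rw [hm, Nat.mul_comm (c u v)] at this
    zify at this
    simp only [w, A]
    linarith
  have hw0 : ∑ k ∈ Finset.range L, w (y k) (y (k + 1)) = 0 := by
    simp only [w]
    rw [Finset.sum_sub_distrib, Finset.sum_sub_distrib,
      Finset.sum_range_sub (fun k => A (y k)), ← Finset.mul_sum, ← Finset.mul_sum, hy]
    zify at hsum
    linarith
  rw [Finset.sum_eq_zero_iff_of_nonneg
    (fun k hk => hw _ _ (hadj k (Finset.mem_range.1 hk)))] at hw0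
  obtain ⟨n, f, hf, hR⟩ := exists_injective_cycle (fun u v => G.Adj u v ∧ w u v = 0) y hL hy
    (fun k _ hk => ⟨hadj k hk, hw0 k (Finset.mem_range.2 hk)⟩)
  refine ⟨⟨n, f, hf, fun i => (hR i).1⟩, ?_⟩
  have h1 : ∑ i, w (f i) (f (i + 1)) = 0 := Finset.sum_eq_zero fun i _ => (hR i).2
  simp only [w] at h1
  rw [Finset.sum_sub_distrib, Finset.sum_sub_distrib, Finset.sum_sub_distrib,
    sum_comp_add_one (fun i => A (f i)), ← Finset.mul_sum, ← Finset.mul_sum] at h1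
  unfold Dicycle.total
  zify
  linarith

end IsSteady

end TokenGame

theorem lemma5 {V : Type*} [Finite V] [Nontrivial V]
    (G : Digraph V) (hsymm : ∀ u v, G.Adj u v → G.Adj v u)
    (hconn : G.toSimpleGraphInclusive.Connected)
    (c : V → V → ℕ) (hc : ∀ u v, G.Adj u v → 0 < c u v)
    (T : V → V → ℕ) (hT : TokenGame.IsGood G T) :
    ∃ p m : ℕ, TokenGame.IsPeriod G c T p ∧ TokenGame.IsMultiplicity G c T p m ∧ 0 < m ∧
      IsGreatest
        (Set.range fun C : TokenGame.Dicycle G => (C.total c : ℚ) / (C.total T : ℚ))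
        ((p : ℚ) / (m : ℚ)) := by
  classical
  have hex : ∃ p, ∃ M, TokenGame.IsSteady G c T p M := TokenGame.exists_isSteady hsymm hc hT.2
  obtain ⟨p, ⟨M, hst⟩, hmin⟩ : ∃ p, TokenGame.IsPeriod G c T p :=
    ⟨Nat.find hex, Nat.find_spec hex, fun q hq => Nat.find_min' hex hq⟩
  obtain ⟨m, hm⟩ : ∃ m, ∀ v, TokenGame.fireCount G c T p M v = m :=
    ⟨_, fun v => hst.fireCount_const hsymm hconn hc v (Classical.arbitrary V)⟩
  have hdeg : ∀ v, ∃ u, G.Adj u v := by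
    intro v
    obtain ⟨u, hu⟩ := hconn.preconnected.exists_adj_of_nontrivial v
    rw [Digraph.toSimpleGraphInclusive, SimpleGraph.fromRel_adj] at hu
    exact ⟨u, hu.2.elim (hsymm _ _) id⟩
  obtain ⟨C, hC⟩ := hst.exists_mul_total_eq hsymm hc hT.2 hdeg hm
  have hp : 0 < p := hst.1
  -- With m = 0 the tight dicycle would carry no token.
  have hm0 : 0 < m := by
    refine Nat.pos_of_ne_zero fun h0 => ?_
    rw [h0, Nat.zero_mul] at hC
    exact (Nat.mul_pos hp (hT.1 C)).ne' hC
  have hmQ : (0 : ℚ) < m := by exact_mod_cast hm0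
  refine ⟨p, m, ⟨⟨M, hst⟩, hmin⟩, fun M' hst' u => ?_, hm0, ⟨C, ?_⟩, ?_⟩
  · rw [← hm u, hst'.fireCount_eq_fireCount hst]
  · have hCQ : (0 : ℚ) < C.total T := by exact_mod_cast hT.1 C
    simp only
    rw [div_eq_div_iff hCQ.ne' hmQ.ne', mul_comm]
    exact_mod_cast hC.symm
  · rintro _ ⟨D, rfl⟩
    have hDQ : (0 : ℚ) < D.total T := by exact_mod_cast hT.1 D
    simp only
    rw [div_le_div_iff₀ hDQ hmQ, mul_comm]
    exact_mod_cast hst.mul_total_le hc hm D
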